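/- Let $H\in(0,1)$ and $K\in(0,1]$, and let $B^{H,K}=(B^{H,K}_t)_{t\ge 0}$ be a bifractional Brownian motion with parameters $H,K$, i.e. a centered Gaussian process with covariance $$\mathbb E\big(B^{H,K}_tB^{H,K}_s\big)=2^{-K}\Big(\big(t^{2H}+s^{2H}\big)^{K}-|t-s|^{2HK}\Big),\qquad s,t\ge 0 .$$ Then $B^{H,K}$ has a $\frac1{HK}$-variation equal to $C_2^{1/(HK)}\,C_{HK}\,t$, where $C_2=2^{\frac{1-K}{2}}$, $C_{HK}=\mathbb E\big(|\xi|^{1/(HK)}\big)$, and $\xi$ is a standard normal random variable. That is, for every $t\ge 0$, $$\sum_{i=0}^{n-1}\Big|B^{H,K}_{(i+1)t/n}-B^{H,K}_{it/n}\Big|^{\frac1{HK}}\;\longrightarrow\; C_2^{1/(HK)}\,C_{HK}\,t\qquad\text{in probability as } n\to\infty .$$ -/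

import Mathlib

open MeasureTheory ProbabilityTheory Filter
open scoped NNReal

/-- The covariance function of bifractional Brownian motion,
`R(t, s) = 2 ^ (-K) * ((t ^ (2 H) + s ^ (2 H)) ^ K - |t - s| ^ (2 H K))`. -/
noncomputable def bifractionalCov (H K : ℝ) (t s : ℝ≥0) : ℝ :=
  (2 : ℝ) ^ (-K) *
    (((t : ℝ) ^ (2 * H) + (s : ℝ) ^ (2 * H)) ^ K - |(t : ℝ) - (s : ℝ)| ^ (2 * H * K))

/-- `B` is a bifractional Brownian motion with parameters `H`, `K` under `P`: a centered Gaussian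
process indexed by `[0, ∞)` with covariance function `bifractionalCov H K`. -/
structure IsBifractionalBrownianMotion {Ω : Type*} {mΩ : MeasurableSpace Ω}
    (H K : ℝ) (B : ℝ≥0 → Ω → ℝ) (P : Measure Ω) : Prop where
  isGaussianProcess : IsGaussianProcess B P
  centered : ∀ t, ∫ ω, B t ω ∂P = 0
  covariance_eq : ∀ t s, ∫ ω, B t ω * B s ω ∂P = bifractionalCov H K t s

/-- The sum `∑_{i < n} |X_{t_{i+1}} - X_{t_i}| ^ α` over the uniform partition `t_i = i t / n`. -/
noncomputable def variationSum {Ω : Type*} (X : ℝ≥0 → Ω → ℝ) (α : ℝ) (t : ℝ≥0) (n : ℕ) (ω : Ω) :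
    ℝ :=
  ∑ i ∈ Finset.range n,
    |X (((i : ℝ≥0) + 1) * t / (n : ℝ≥0)) ω - X ((i : ℝ≥0) * t / (n : ℝ≥0)) ω| ^ α

/-- The process `X` admits an `α`-variation, equal to the process `V`: for every `t ≥ 0` the
sums `variationSum X α t n` converge in probability to `V t` as `n → ∞`. -/
def HasAlphaVariation {Ω : Type*} {mΩ : MeasurableSpace Ω}
    (X : ℝ≥0 → Ω → ℝ) (α : ℝ) (V : ℝ≥0 → Ω → ℝ) (P : Measure Ω) : Prop :=
  ∀ t : ℝ≥0, TendstoInMeasure P (fun n : ℕ => variationSum X α t n) atTop (V t)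

open scoped Topology

/-! By self-similarity, the increments over mesh `t / n`, rescaled by `(t / n) ^ (-(H * K))`, have a
covariance `Γ i j` free of `n` and `t` (`bifractionalCov_mul`). Since `p * (H * K) = 1`, the
variation sum is `t` times the average of the `p`-th absolute powers of these rescaled increments.

`Γ` is `2 ^ (-K)` times a mixed second difference of `(x ^ (2 H) + y ^ (2 H)) ^ K`, negligible away
from the axes, plus a second difference of `|x| ^ (2 H K)` at `i - j`, which is 2 on the diagonal
and decays off it because `2 H K < 2`. So variances tend to `2 ^ (1 - K) = C₂ ^ 2` and distant
increments decorrelate. For Gaussian pairs this passes to absolute powers by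
`continuous_gaussianPowerCov`, and an L² law of large numbers
(`tendstoInMeasure_average_of_correlation_small`) concludes. Powers are centered at the limiting
mean `L`, so no separate bias estimate is needed. -/

/-! ### Absolute powers of Gaussian pairs. -/

/-- A centered Gaussian pair `(X, Y)` has the law of `(a U, b U + c V)` with `U`, `V` independent
standard normal variables. -/
lemma integral_comp_hasGaussianLaw_prodMk {Ω : Type*} {mΩ : MeasurableSpace Ω} {P : Measure Ω}
    {X Y : Ω → ℝ} (hXY : HasGaussianLaw (fun ω ↦ (X ω, Y ω)) P)
    (hX0 : ∫ ω, X ω ∂P = 0) (hY0 : ∫ ω, Y ω ∂P = 0) {a b : ℝ} (ha : 0 < a)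
    (hXX : ∫ ω, X ω * X ω ∂P = a ^ 2) (hb : ∫ ω, X ω * Y ω ∂P = a * b)
    {f : ℝ × ℝ → ℝ} (hf : Continuous f) :
    ∫ ω, f (X ω, Y ω) ∂P =
      ∫ z, f (a * z.1, b * z.1 + √(∫ ω, Y ω * Y ω ∂P - b ^ 2) * z.2)
        ∂((gaussianReal 0 1).prod (gaussianReal 0 1)) := by
  have hP := hXY.isProbabilityMeasure
  set c := √(∫ ω, Y ω * Y ω ∂P - b ^ 2) with hc
  -- Gram–Schmidt: `Z` is the part of `Y` uncorrelated with `U`, hence independent of it by joint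
  -- Gaussianity.
  set U : Ω → ℝ := fun ω ↦ X ω / a with hU
  set Z : Ω → ℝ := fun ω ↦ Y ω - b * (X ω / a) with hZ
  have mX : MemLp X 2 P := hXY.fst.memLp_two
  have mY : MemLp Y 2 P := hXY.snd.memLp_two
  have iXX : Integrable (fun ω ↦ X ω * X ω) P := mX.integrable_mul mX
  have iXY : Integrable (fun ω ↦ X ω * Y ω) P := mX.integrable_mul mY
  have iYY : Integrable (fun ω ↦ Y ω * Y ω) P := mY.integrable_mul mY
  have iX : Integrable X P := hXY.fst.integrable
  have iY : Integrable Y P := hXY.snd.integrable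
  have hUZ : HasGaussianLaw (fun ω ↦ (U ω, Z ω)) P := by
    let T : ℝ × ℝ →L[ℝ] ℝ × ℝ :=
      (a⁻¹ • ContinuousLinearMap.fst ℝ ℝ ℝ).prod
        (ContinuousLinearMap.snd ℝ ℝ ℝ - (b * a⁻¹) • ContinuousLinearMap.fst ℝ ℝ ℝ)
    refine (hXY.map_fun T).congr (Eventually.of_forall fun ω ↦ ?_)
    simp only [T, hU, hZ, ContinuousLinearMap.prod_apply, smul_apply,
      sub_apply, ContinuousLinearMap.coe_fst', ContinuousLinearMap.coe_snd',
      smul_eq_mul, Prod.mk.injEq]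
    constructor <;> ring
  have hU0 : ∫ ω, U ω ∂P = 0 := by simp [hU, integral_div, hX0]
  have hZ0 : ∫ ω, Z ω ∂P = 0 := by
    simp only [hZ]
    rw [integral_sub iY ((iX.div_const a).const_mul b), integral_const_mul, integral_div, hX0, hY0]
    simp
  have hUU : ∫ ω, U ω ^ 2 ∂P = 1 := by
    have : ∀ ω, U ω ^ 2 = X ω * X ω / a ^ 2 := fun ω ↦ by simp only [hU]; ring
    simp_rw [this]
    rw [integral_div, hXX, div_self (by positivity)]
  have hUZ0 : ∫ ω, U ω * Z ω ∂P = 0 := by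
    have : ∀ ω, U ω * Z ω = X ω * Y ω / a - b * (X ω * X ω / a ^ 2) := fun ω ↦ by
      simp only [hU, hZ]; ring
    simp_rw [this]
    rw [integral_sub (iXY.div_const a) ((iXX.div_const _).const_mul b), integral_const_mul,
      integral_div, integral_div, hXX, hb]
    field_simp
    ring
  have hZZ : ∫ ω, Z ω ^ 2 ∂P = ∫ ω, Y ω * Y ω ∂P - b ^ 2 := by
    have : ∀ ω, Z ω ^ 2 = Y ω * Y ω - (2 * b / a * (X ω * Y ω) - b ^ 2 / a ^ 2 * (X ω * X ω)) :=
      fun ω ↦ by simp only [hZ]; ring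
    simp_rw [this]
    rw [integral_sub iYY (by exact (iXY.const_mul _).sub (iXX.const_mul _)),
      integral_sub (iXY.const_mul _) (iXX.const_mul _), integral_const_mul, integral_const_mul,
      hXX, hb]
    field_simp
    ring
  have hc2 : c ^ 2 = ∫ ω, Y ω * Y ω ∂P - b ^ 2 := by
    rw [hc, Real.sq_sqrt]
    rw [← hZZ]
    exact integral_nonneg fun ω ↦ sq_nonneg _
  have hind : IndepFun U Z P := by
    refine hUZ.indepFun_of_covariance_eq_zero ?_
    rw [covariance_eq_sub hUZ.fst.memLp_two hUZ.snd.memLp_two]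
    simp [hU0, hZ0, hUZ0]
  have lU : P.map U = gaussianReal 0 1 := by
    rw [hUZ.fst.map_eq_gaussianReal, hU0, variance_of_integral_eq_zero hUZ.fst.aemeasurable hU0,
      hUU]
    simp
  -- `c` may vanish, so `Z` is described as a scaled normal rather than normalized.
  have lZ : P.map Z = (gaussianReal 0 1).map (c * ·) := by
    rw [hUZ.snd.map_eq_gaussianReal, hZ0, variance_of_integral_eq_zero hUZ.snd.aemeasurable hZ0,
      hZZ, ← hc2, gaussianReal_map_const_mul]
    congr 1
    · simp
    · ext; simp [sq_nonneg]
  have lUZ : P.map (fun ω ↦ (U ω, Z ω)) =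
      ((gaussianReal 0 1).prod (gaussianReal 0 1)).map (Prod.map id (c * ·)) := by
    rw [(indepFun_iff_map_prod_eq_prod_map_map hUZ.fst.aemeasurable hUZ.snd.aemeasurable).1 hind,
      lU, lZ, ← Measure.map_prod_map _ _ measurable_id (by fun_prop), Measure.map_id]
  have h1 : ∀ ω, f (X ω, Y ω) = (fun z : ℝ × ℝ ↦ f (a * z.1, b * z.1 + z.2)) (U ω, Z ω) := fun ω ↦ by
    simp only [hU, hZ]
    congr 2
    · field_simp
    · ring
  have hcont : Continuous (fun z : ℝ × ℝ ↦ f (a * z.1, b * z.1 + z.2)) := by fun_prop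
  simp_rw [h1]
  rw [← integral_map hUZ.aemeasurable hcont.aestronglyMeasurable, lUZ,
    integral_map (by fun_prop) hcont.aestronglyMeasurable]
  simp

/-- The covariance of `|a U| ^ p - L` and `|b U + c V| ^ p - L` for independent standard normal
variables `U`, `V`, as a function of `q = (a, b, c)`. -/
noncomputable def gaussianPowerCov (p L : ℝ) (q : ℝ × ℝ × ℝ) : ℝ :=
  ∫ z, (|q.1 * z.1| ^ p - L) * (|q.2.1 * z.1 + q.2.2 * z.2| ^ p - L)
    ∂((gaussianReal 0 1).prod (gaussianReal 0 1))

/-- Dominated convergence: on a ball of parameters the integrand is at most a multiple of `‖z‖ ^ (2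
* p)` plus a constant, and Gaussian measures have all moments. -/
lemma continuous_gaussianPowerCov {p : ℝ} (hp : 0 < p) (L : ℝ) :
    Continuous (gaussianPowerCov p L) := by
  refine continuous_iff_continuousAt.2 fun q₀ ↦ ?_
  set R := ‖q₀‖ + 1 with hR
  have hRpos : 0 < R := by positivity
  have hq : ∀ᶠ q in 𝓝 q₀, ‖q‖ < R :=
    continuous_norm.continuousAt.eventually_lt continuousAt_const (by simp [hR])
  have key : ∀ x y : ℝ, 0 ≤ x → 0 ≤ y → ∀ m, x ≤ m → y ≤ m →
      |(x - L) * (y - L)| ≤ 2 * m ^ 2 + 2 * L ^ 2 := by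
    intro x y hx hy m hxm hym
    rw [abs_le]
    constructor <;> nlinarith [sq_nonneg (x + y), sq_nonneg (x - y), sq_nonneg (x + L),
      sq_nonneg (y + L), sq_nonneg (x - L), sq_nonneg (y - L), sq_nonneg (x + y - 2 * L),
      pow_le_pow_left₀ hx hxm 2, pow_le_pow_left₀ hy hym 2]
  refine continuousAt_of_dominated
    (bound := fun z : ℝ × ℝ ↦ 2 * ((2 * R) ^ p) ^ 2 * ‖z‖ ^ (2 * p) + 2 * L ^ 2) ?_ ?_ ?_ ?_
  · refine Eventually.of_forall fun q ↦ Continuous.aestronglyMeasurable ?_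
    have := hp.le
    fun_prop (disch := assumption)
  · filter_upwards [hq] with q hq
    refine Eventually.of_forall fun z ↦ ?_
    have h1 : |q.1| ≤ R := (norm_fst_le q).trans hq.le
    have h2 : |q.2.1| ≤ R := (norm_fst_le q.2).trans ((norm_snd_le q).trans hq.le)
    have h3 : |q.2.2| ≤ R := (norm_snd_le q.2).trans ((norm_snd_le q).trans hq.le)
    have hz1 : |z.1| ≤ ‖z‖ := norm_fst_le z
    have hz2 : |z.2| ≤ ‖z‖ := norm_snd_le z
    have e1 : |q.1 * z.1| ≤ 2 * R * ‖z‖ := by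
      rw [abs_mul]
      nlinarith [mul_le_mul h1 hz1 (abs_nonneg _) hRpos.le, mul_nonneg hRpos.le (norm_nonneg z)]
    have e2 : |q.2.1 * z.1 + q.2.2 * z.2| ≤ 2 * R * ‖z‖ := by
      refine (abs_add_le _ _).trans ?_
      rw [abs_mul, abs_mul]
      nlinarith [mul_le_mul h2 hz1 (abs_nonneg _) hRpos.le,
        mul_le_mul h3 hz2 (abs_nonneg _) hRpos.le]
    have := key (|q.1 * z.1| ^ p) (|q.2.1 * z.1 + q.2.2 * z.2| ^ p) (by positivity) (by positivity)
      ((2 * R * ‖z‖) ^ p) (Real.rpow_le_rpow (abs_nonneg _) e1 hp.le)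
      (Real.rpow_le_rpow (abs_nonneg _) e2 hp.le)
    rw [Real.norm_eq_abs]
    refine this.trans_eq ?_
    rw [Real.mul_rpow (by positivity) (by positivity), mul_pow, mul_comm 2 p,
      Real.rpow_mul (norm_nonneg z), Real.rpow_two]
    ring
  · refine Integrable.add (Integrable.const_mul ?_ _) (integrable_const _)
    have h := (IsGaussian.memLp_id ((gaussianReal 0 1).prod (gaussianReal 0 1))
      (ENNReal.ofReal (2 * p)) ENNReal.ofReal_ne_top).integrable_norm_rpow (by simpa using hp)
      ENNReal.ofReal_ne_top
    rwa [ENNReal.toReal_ofReal (by positivity)] at h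
  · refine Eventually.of_forall fun z ↦ Continuous.continuousAt ?_
    have := hp.le
    fun_prop (disch := assumption)


lemma memLp_two_abs_rpow {Ω : Type*} {mΩ : MeasurableSpace Ω} {P : Measure Ω}
    {X : Ω → ℝ} (hX : HasGaussianLaw X P) {p : ℝ} (hp : 0 < p) :
    MemLp (fun ω ↦ |X ω| ^ p) 2 P := by
  have h := (hX.memLp (p := 2 * ENNReal.ofReal p)
    (ENNReal.mul_ne_top (by simp) ENNReal.ofReal_ne_top)).norm_rpow_div (ENNReal.ofReal p)
  rw [ENNReal.toReal_ofReal hp.le, ENNReal.mul_div_cancel_right (by simpa using hp)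
    ENNReal.ofReal_ne_top] at h
  exact h

/-- With `b = 0` the two factors are independent, and this `L` is their exact mean. -/
lemma gaussianPowerCov_eq_zero {p σ : ℝ} (hp : 0 < p) (hσ : 0 ≤ σ) :
    gaussianPowerCov p (σ ^ p * ∫ u, |u| ^ p ∂(gaussianReal 0 1)) (σ, 0, σ) = 0 := by
  set L := σ ^ p * ∫ u, |u| ^ p ∂(gaussianReal 0 1) with hL
  have hi : Integrable (fun u : ℝ ↦ |u| ^ p) (gaussianReal 0 1) :=
    (memLp_two_abs_rpow IsGaussian.hasGaussianLaw_id hp).integrable one_le_two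
  have h0 : ∫ u, (|σ * u| ^ p - L) ∂(gaussianReal 0 1) = 0 := by
    have : ∀ u : ℝ, |σ * u| ^ p = σ ^ p * |u| ^ p := fun u ↦ by
      rw [abs_mul, abs_of_nonneg hσ, Real.mul_rpow hσ (abs_nonneg _)]
    simp_rw [this]
    rw [integral_sub (hi.const_mul _) (integrable_const _), integral_const_mul]
    simp [hL]
  simp only [gaussianPowerCov, zero_mul, zero_add]
  rw [integral_prod_mul (fun u ↦ |σ * u| ^ p - L) (fun u ↦ |σ * u| ^ p - L), h0, zero_mul]

lemma integral_abs_rpow_hasGaussianLaw {Ω : Type*} {mΩ : MeasurableSpace Ω} {P : Measure Ω}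
    {X : Ω → ℝ} (hX : HasGaussianLaw X P) (hX0 : ∫ ω, X ω ∂P = 0) (q : ℝ) :
    ∫ ω, |X ω| ^ q ∂P = √(∫ ω, X ω * X ω ∂P) ^ q * ∫ u, |u| ^ q ∂(gaussianReal 0 1) := by
  have hs : 0 ≤ ∫ ω, X ω * X ω ∂P := integral_nonneg fun ω ↦ mul_self_nonneg _
  have l : P.map X = (gaussianReal 0 1).map (√(∫ ω, X ω * X ω ∂P) * ·) := by
    rw [hX.map_eq_gaussianReal, hX0, variance_of_integral_eq_zero hX.aemeasurable hX0,
      gaussianReal_map_const_mul]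
    simp_rw [← pow_two] at hs ⊢
    congr 1
    · simp
    · ext; simp [hs]
  have hm : Measurable fun u : ℝ ↦ |u| ^ q := by fun_prop
  rw [← integral_map (f := fun u : ℝ ↦ |u| ^ q) hX.aemeasurable hm.aestronglyMeasurable, l,
    integral_map (by fun_prop) hm.aestronglyMeasurable, ← integral_const_mul]
  refine integral_congr_ae (Eventually.of_forall fun u ↦ ?_)
  simp only
  rw [abs_mul, abs_of_nonneg (Real.sqrt_nonneg _),
    Real.mul_rpow (Real.sqrt_nonneg _) (abs_nonneg _)]

/-- The centered absolute powers of a centered Gaussian variable have bounded second moments. -/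
lemma integral_sq_abs_rpow_sub_le {Ω : Type*} {mΩ : MeasurableSpace Ω} {P : Measure Ω}
    {X : Ω → ℝ} (hX : HasGaussianLaw X P) (hX0 : ∫ ω, X ω ∂P = 0) {p : ℝ} (hp : 0 < p) (L : ℝ)
    {A : ℝ} (hA : ∫ ω, X ω * X ω ∂P ≤ A) :
    ∫ ω, (|X ω| ^ p - L) ^ 2 ∂P ≤
      2 * (√A ^ (p * 2) * ∫ u, |u| ^ (p * 2) ∂(gaussianReal 0 1)) + 2 * L ^ 2 := by
  have := hX.isProbabilityMeasure
  have hm := memLp_two_abs_rpow hX hp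
  have hsq : ∀ ω, (|X ω| ^ p) ^ 2 = |X ω| ^ (p * 2) := fun ω ↦ by
    rw [Real.rpow_mul (abs_nonneg _), Real.rpow_two]
  calc ∫ ω, (|X ω| ^ p - L) ^ 2 ∂P ≤ ∫ ω, (2 * (|X ω| ^ p) ^ 2 + 2 * L ^ 2) ∂P := by
        refine integral_mono (hm.sub (memLp_const L)).integrable_sq
          ((hm.integrable_sq.const_mul 2).add (integrable_const _)) fun ω ↦ ?_
        simp only
        nlinarith [sq_nonneg (|X ω| ^ p + L)]
    _ = 2 * (√(∫ ω, X ω * X ω ∂P) ^ (p * 2) * ∫ u, |u| ^ (p * 2) ∂(gaussianReal 0 1)) +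
          2 * L ^ 2 := by
        rw [integral_add (hm.integrable_sq.const_mul 2) (integrable_const _), integral_const_mul,
          ← integral_abs_rpow_hasGaussianLaw hX hX0]
        simp [hsq]
    _ ≤ _ := by
        gcongr

/-! ### An L² law of large numbers. -/

/-- A law of large numbers for triangular arrays whose entries are uniformly bounded in `L²` and
asymptotically uncorrelated away from the axes and from the diagonal. -/
lemma tendstoInMeasure_average_of_correlation_small {Ω : Type*} {mΩ : MeasurableSpace Ω}
    {P : Measure Ω} [IsProbabilityMeasure P] {Y : ℕ → ℕ → Ω → ℝ} (hY : ∀ n i, MemLp (Y n i) 2 P)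
    {D : ℝ} (hD : ∀ n ≠ 0, ∀ i, ∫ ω, Y n i ω ^ 2 ∂P ≤ D)
    (hsmall : ∀ ε > 0, ∃ M : ℕ, ∀ n ≠ 0, ∀ i j, M ≤ i → M ≤ j → (i + M ≤ j ∨ j + M ≤ i) →
      |∫ ω, Y n i ω * Y n j ω ∂P| ≤ ε) :
    TendstoInMeasure P (fun (n : ℕ) ω ↦ (n : ℝ)⁻¹ * ∑ i ∈ Finset.range n, Y n i ω) atTop
      (fun _ ↦ (0 : ℝ)) := by
  have hD0 : 0 ≤ D := (integral_nonneg fun ω ↦ sq_nonneg _).trans (hD 1 one_ne_zero 0)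
  have hint : ∀ n i j, Integrable (fun ω ↦ Y n i ω * Y n j ω) P :=
    fun n i j ↦ (hY n i).integrable_mul (hY n j)
  have hDD : ∀ n ≠ 0, ∀ i j, |∫ ω, Y n i ω * Y n j ω ∂P| ≤ D := by
    intro n hn i j
    have h1 : ∫ ω, |Y n i ω * Y n j ω| ∂P ≤ ∫ ω, (Y n i ω ^ 2 / 2 + Y n j ω ^ 2 / 2) ∂P := by
      refine integral_mono (hint n i j).abs
        (((hY n i).integrable_sq.div_const 2).add ((hY n j).integrable_sq.div_const 2)) fun ω ↦ ?_
      simp only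
      rw [abs_le]
      constructor <;> nlinarith [sq_nonneg (Y n i ω + Y n j ω), sq_nonneg (Y n i ω - Y n j ω)]
    rw [integral_add ((hY n i).integrable_sq.div_const 2) ((hY n j).integrable_sq.div_const 2),
      integral_div, integral_div] at h1
    linarith [abs_integral_le_integral_abs (f := fun ω ↦ Y n i ω * Y n j ω) (μ := P),
      hD n hn i, hD n hn j]
  have hexp : ∀ n : ℕ, ∫ ω, ((n : ℝ)⁻¹ * ∑ i ∈ Finset.range n, Y n i ω) ^ 2 ∂P =
      (n : ℝ)⁻¹ ^ 2 * ∑ i ∈ Finset.range n, ∑ j ∈ Finset.range n,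
        ∫ ω, Y n i ω * Y n j ω ∂P := by
    intro n
    simp_rw [mul_pow, pow_two (Finset.sum _ _), Finset.sum_mul_sum]
    rw [integral_const_mul,
      integral_finsetSum _ fun i _ ↦ integrable_finsetSum _ fun j _ ↦ hint n i j]
    congr 1
    exact Finset.sum_congr rfl fun i _ ↦ integral_finsetSum _ fun j _ ↦ hint n i j
  have hL2 : ∀ n : ℕ, MemLp (fun ω ↦ (n : ℝ)⁻¹ * ∑ i ∈ Finset.range n, Y n i ω) 2 P :=
    fun n ↦ (memLp_finsetSum _ fun i _ ↦ hY n i).const_mul _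
  have hlim : Tendsto (fun n : ℕ ↦ ∫ ω, ((n : ℝ)⁻¹ * ∑ i ∈ Finset.range n, Y n i ω) ^ 2 ∂P) atTop
      (𝓝 0) := by
    rw [Metric.tendsto_atTop]
    intro ε hε
    obtain ⟨M, hM⟩ := hsmall (ε / 2) (by positivity)
    -- This threshold makes the contribution `4 * M * D / n` of the bad pairs less than `ε / 2`.
    obtain ⟨N, hN⟩ := exists_nat_gt (8 * M * D / ε)
    refine ⟨N + 1, fun n hn ↦ ?_⟩
    have hn0 : n ≠ 0 := by omega
    have hnpos : (0 : ℝ) < n := by positivity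
    have hnN : 8 * M * D / ε < n := hN.trans (by exact_mod_cast hn)
    have hrow : ∀ i ∈ Finset.range n, ∑ j ∈ Finset.range n, |∫ ω, Y n i ω * Y n j ω ∂P| ≤
        n * (ε / 2) + 3 * M * D + (if i < M then n * D else 0) := by
      intro i _
      -- Bad pairs cost `D` each: at most `3 * M` per row near an axis or the diagonal, and entire
      -- rows when `i < M`.
      have hterm : ∀ j ∈ Finset.range n, |∫ ω, Y n i ω * Y n j ω ∂P| ≤
          ε / 2 + ((if j < M then D else 0) + (if j ∈ Finset.Ico (i - M) (i + M) then D else 0)) +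
            (if i < M then D else 0) := by
        intro j _
        have e0 : 0 ≤ ε / 2 := by positivity
        have := hDD n hn0 i j
        by_cases h : M ≤ i ∧ M ≤ j ∧ (i + M ≤ j ∨ j + M ≤ i)
        · have := hM n hn0 i j h.1 h.2.1 h.2.2
          split_ifs <;> linarith
        · simp only [Finset.mem_Ico]
          split_ifs <;> first | linarith | (exfalso; omega)
      refine (Finset.sum_le_sum hterm).trans ?_
      rw [Finset.sum_add_distrib, Finset.sum_add_distrib, Finset.sum_add_distrib,
        Finset.sum_const, Finset.sum_const, Finset.card_range, ← Finset.sum_filter,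
        ← Finset.sum_filter, Finset.sum_const, Finset.sum_const]
      have c1 : ((Finset.range n).filter (· < M)).card ≤ M := by
        refine (Finset.card_le_card (t := Finset.range M) fun j hj ↦ ?_).trans_eq
          (Finset.card_range M)
        simpa using (Finset.mem_filter.1 hj).2
      have c2 : ((Finset.range n).filter (· ∈ Finset.Ico (i - M) (i + M))).card ≤ 2 * M := by
        refine (Finset.card_le_card (t := Finset.Ico (i - M) (i + M)) fun j hj ↦
          (Finset.mem_filter.1 hj).2).trans ?_
        rw [Nat.card_Ico]
        omega
      have c1' : (((Finset.range n).filter (· < M)).card : ℝ) ≤ M := by exact_mod_cast c1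
      have c2' : (((Finset.range n).filter (· ∈ Finset.Ico (i - M) (i + M))).card : ℝ) ≤ 2 * M := by
        exact_mod_cast c2
      simp only [nsmul_eq_mul]
      have := mul_le_mul_of_nonneg_right c1' hD0
      have := mul_le_mul_of_nonneg_right c2' hD0
      split_ifs <;> linarith
    have htot : ∑ i ∈ Finset.range n, ∑ j ∈ Finset.range n, |∫ ω, Y n i ω * Y n j ω ∂P| ≤
        n * (n * (ε / 2) + 4 * M * D) := by
      refine (Finset.sum_le_sum hrow).trans ?_
      rw [Finset.sum_add_distrib, Finset.sum_const, Finset.card_range, ← Finset.sum_filter,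
        Finset.sum_const]
      have c1 : ((Finset.range n).filter (· < M)).card ≤ M := by
        refine (Finset.card_le_card (t := Finset.range M) fun j hj ↦ ?_).trans_eq
          (Finset.card_range M)
        simpa using (Finset.mem_filter.1 hj).2
      have c1' : (((Finset.range n).filter (· < M)).card : ℝ) ≤ M := by exact_mod_cast c1
      simp only [nsmul_eq_mul]
      have := mul_le_mul_of_nonneg_right c1' (mul_nonneg hnpos.le hD0)
      linarith
    rw [Real.dist_eq, sub_zero, hexp, abs_mul, abs_of_nonneg (by positivity)]
    have habs : |∑ i ∈ Finset.range n, ∑ j ∈ Finset.range n, ∫ ω, Y n i ω * Y n j ω ∂P| ≤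
        n * (n * (ε / 2) + 4 * M * D) :=
      (Finset.abs_sum_le_sum_abs _ _).trans
        ((Finset.sum_le_sum fun i _ ↦ Finset.abs_sum_le_sum_abs _ _).trans htot)
    refine (mul_le_mul_of_nonneg_left habs (by positivity)).trans_lt ?_
    rw [div_lt_iff₀ hε] at hnN
    have : (n : ℝ)⁻¹ ^ 2 * (n * (n * (ε / 2) + 4 * M * D)) = ε / 2 + 4 * M * D / n := by
      field_simp
    rw [this]
    have : 4 * M * D / n < ε / 2 := by
      rw [div_lt_iff₀ hnpos]
      linarith
    linarith
  refine tendstoInMeasure_of_tendsto_eLpNorm (p := 2) two_ne_zero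
    (fun n ↦ (hL2 n).aestronglyMeasurable) aestronglyMeasurable_const ?_
  have heq : ∀ n : ℕ, eLpNorm ((fun ω ↦ (n : ℝ)⁻¹ * ∑ i ∈ Finset.range n, Y n i ω) - fun _ ↦ 0) 2 P =
      ENNReal.ofReal ((∫ ω, ((n : ℝ)⁻¹ * ∑ i ∈ Finset.range n, Y n i ω) ^ 2 ∂P) ^ (2⁻¹ : ℝ)) := by
    intro n
    have h0 : ((fun ω ↦ (n : ℝ)⁻¹ * ∑ i ∈ Finset.range n, Y n i ω) - fun _ ↦ 0) =
        fun ω ↦ (n : ℝ)⁻¹ * ∑ i ∈ Finset.range n, Y n i ω := by ext; simp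
    rw [h0, (hL2 n).eLpNorm_eq_integral_rpow_norm two_ne_zero (by simp)]
    simp [mul_pow]
  simp_rw [heq]
  have := ENNReal.tendsto_ofReal (hlim.rpow_const (p := (2⁻¹ : ℝ)) (Or.inr (by norm_num)))
  simpa using this

/-! ### Second differences of power functions. -/

/-- Applied twice, this mean value bound controls a second difference by a second derivative. -/
lemma abs_sub_le_of_hasDerivAt {f f' : ℝ → ℝ} {x C : ℝ}
    (hf : ∀ u ∈ Set.Icc x (x + 1), HasDerivAt f (f' u) u)
    (hC : ∀ u ∈ Set.Icc x (x + 1), |f' u| ≤ C) : |f (x + 1) - f x| ≤ C := by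
  have := (convex_Icc x (x + 1)).norm_image_sub_le_of_norm_hasDerivWithin_le
    (fun u hu ↦ (hf u hu).hasDerivWithinAt) hC
    (Set.left_mem_Icc.2 (by linarith)) (Set.right_mem_Icc.2 (by linarith))
  simpa using this

/-- The mixed second difference of `(x ^ (2 H) + y ^ (2 H)) ^ K` is small away from the axes. -/
lemma abs_mixed_difference_le {H K : ℝ} (hH : H ∈ Set.Ioo (0 : ℝ) 1) (hK : K ∈ Set.Ioc (0 : ℝ) 1)
    {m x y : ℝ} (hm : 1 ≤ m) (hx : m ≤ x) (hy : m ≤ y) :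
    |(((x + 1) ^ (2 * H) + (y + 1) ^ (2 * H)) ^ K - ((x + 1) ^ (2 * H) + y ^ (2 * H)) ^ K) -
      ((x ^ (2 * H) + (y + 1) ^ (2 * H)) ^ K - (x ^ (2 * H) + y ^ (2 * H)) ^ K)| ≤
      4 * (m * m) ^ (H * K - 1) := by
  obtain ⟨hH0, hH1⟩ := hH
  obtain ⟨hK0, hK1⟩ := hK
  have hsum : ∀ u w : ℝ, 0 < u → 0 < w → u ^ (2 * H) + w ^ (2 * H) ≠ 0 := fun u w hu hw ↦ by
    positivity
  refine abs_sub_le_of_hasDerivAt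
    (f := fun u ↦ (u ^ (2 * H) + (y + 1) ^ (2 * H)) ^ K - (u ^ (2 * H) + y ^ (2 * H)) ^ K)
    (f' := fun u ↦ 2 * H * u ^ (2 * H - 1) * K * (u ^ (2 * H) + (y + 1) ^ (2 * H)) ^ (K - 1) -
      2 * H * u ^ (2 * H - 1) * K * (u ^ (2 * H) + y ^ (2 * H)) ^ (K - 1)) ?_ ?_
  · intro u hu
    have hu0 : 0 < u := by linarith [hu.1]
    refine HasDerivAt.sub ?_ ?_
    · exact ((Real.hasDerivAt_rpow_const (Or.inl hu0.ne')).add_const _).rpow_const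
        (Or.inl (hsum _ _ hu0 (by linarith)))
    · exact ((Real.hasDerivAt_rpow_const (Or.inl hu0.ne')).add_const _).rpow_const
        (Or.inl (hsum _ _ hu0 (by linarith)))
  intro u hu
  have hum : m ≤ u := hx.trans hu.1
  have hu0 : 0 < u := by linarith
  refine abs_sub_le_of_hasDerivAt
    (f := fun w ↦ 2 * H * u ^ (2 * H - 1) * K * (u ^ (2 * H) + w ^ (2 * H)) ^ (K - 1))
    (f' := fun w ↦ 2 * H * u ^ (2 * H - 1) * K *
      (2 * H * w ^ (2 * H - 1) * (K - 1) * (u ^ (2 * H) + w ^ (2 * H)) ^ (K - 1 - 1))) ?_ ?_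
  · intro w hw
    have hw0 : 0 < w := by linarith [hw.1]
    exact (((Real.hasDerivAt_rpow_const (Or.inl hw0.ne')).const_add _).rpow_const
      (Or.inl (hsum _ _ hu0 hw0))).const_mul _
  intro w hw
  have hwm : m ≤ w := hy.trans hw.1
  have hw0 : 0 < w := by linarith
  -- As `K - 2 < 0`, this lower bound on the base bounds the power from above; the total exponent of
  -- `u * w` is then `(2 * H - 1) + H * (K - 2) = H * K - 1 < 0`.
  have hamgm : (u * w) ^ H ≤ u ^ (2 * H) + w ^ (2 * H) := by
    rw [Real.mul_rpow hu0.le hw0.le, mul_comm 2 H, Real.rpow_mul hu0.le, Real.rpow_mul hw0.le,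
      Real.rpow_two, Real.rpow_two]
    nlinarith [sq_nonneg (u ^ H - w ^ H), Real.rpow_pos_of_pos hu0 H, Real.rpow_pos_of_pos hw0 H]
  have h1 : (u ^ (2 * H) + w ^ (2 * H)) ^ (K - 1 - 1) ≤ (u * w) ^ (H * (K - 1 - 1)) := by
    rw [Real.rpow_mul (mul_pos hu0 hw0).le]
    exact Real.rpow_le_rpow_of_nonpos (Real.rpow_pos_of_pos (mul_pos hu0 hw0) _) hamgm (by linarith)
  have h2 : (u * w) ^ (H * K - 1) ≤ (m * m) ^ (H * K - 1) :=
    Real.rpow_le_rpow_of_nonpos (by positivity) (by gcongr) (by nlinarith)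
  have h3 : (u * w) ^ (H * K - 1) =
      u ^ (2 * H - 1) * w ^ (2 * H - 1) * (u * w) ^ (H * (K - 1 - 1)) := by
    rw [← Real.mul_rpow hu0.le hw0.le, ← Real.rpow_add (by positivity)]
    ring_nf
  have h4 : 2 * H * u ^ (2 * H - 1) * K *
      (2 * H * w ^ (2 * H - 1) * (K - 1) * (u ^ (2 * H) + w ^ (2 * H)) ^ (K - 1 - 1)) =
      -(4 * (H * H * K * (1 - K)) * (u ^ (2 * H - 1) * w ^ (2 * H - 1) *
        (u ^ (2 * H) + w ^ (2 * H)) ^ (K - 1 - 1))) := by ring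
  have hc0 : 0 ≤ H * H * K * (1 - K) := mul_nonneg (by positivity) (by linarith)
  have hc1 : H * H * K * (1 - K) ≤ 1 := by
    refine mul_le_one₀ (mul_le_one₀ (mul_le_one₀ hH1.le hH0.le hH1.le) hK0.le hK1) ?_ ?_ <;>
      linarith
  rw [h4, abs_neg, abs_of_nonneg (by positivity)]
  calc _ ≤ 4 * 1 * (u ^ (2 * H - 1) * w ^ (2 * H - 1) * (u * w) ^ (H * (K - 1 - 1))) := by gcongr
    _ ≤ _ := by rw [← h3, mul_one]; gcongr

/-- The second difference of `x ^ β` tends to zero at infinity when `β < 2`. -/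
lemma abs_second_difference_rpow_le {β : ℝ} (h0 : 0 < β) (h2 : β < 2) {m x : ℝ} (hm : 0 < m)
    (hx : m ≤ x - 1) :
    |(x + 1) ^ β + (x - 1) ^ β - 2 * x ^ β| ≤ 2 * m ^ (β - 2) := by
  -- The central difference is rewritten as an iterated forward difference based at `x - 1`.
  have key : |((x - 1 + 1 + 1) ^ β - (x - 1 + 1) ^ β) - ((x - 1 + 1) ^ β - (x - 1) ^ β)| ≤
      2 * m ^ (β - 2) := by
    refine abs_sub_le_of_hasDerivAt (f := fun u ↦ (u + 1) ^ β - u ^ β)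
      (f' := fun u ↦ β * (u + 1) ^ (β - 1) - β * u ^ (β - 1)) ?_ ?_
    · intro u hu
      have hu0 : 0 < u := by linarith [hu.1]
      refine HasDerivAt.sub ?_ (Real.hasDerivAt_rpow_const (Or.inl hu0.ne'))
      have := ((hasDerivAt_id u).add_const 1).rpow_const (p := β)
        (Or.inl (by simp only [id]; positivity))
      simpa using this
    intro u hu
    refine abs_sub_le_of_hasDerivAt (f := fun w ↦ β * w ^ (β - 1))
      (f' := fun w ↦ β * ((β - 1) * w ^ (β - 1 - 1))) ?_ ?_
    · intro w hw
      have hw0 : 0 < w := by linarith [hw.1, hu.1]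
      exact (Real.hasDerivAt_rpow_const (Or.inl hw0.ne')).const_mul _
    intro w hw
    have hw0 : m ≤ w := by linarith [hw.1, hu.1]
    have h1 : w ^ (β - 1 - 1) ≤ m ^ (β - 2) := by
      rw [sub_sub, one_add_one_eq_two]
      exact Real.rpow_le_rpow_of_nonpos hm hw0 (by linarith)
    have h3 : 0 < w ^ (β - 1 - 1) := Real.rpow_pos_of_pos (hm.trans_le hw0) _
    rw [abs_mul, abs_mul, abs_of_pos h0, abs_of_pos h3, ← mul_assoc]
    have h4 : |β - 1| ≤ 1 := abs_le.2 ⟨by linarith, by linarith⟩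
    refine mul_le_mul ?_ h1 h3.le (by norm_num)
    nlinarith [abs_nonneg (β - 1)]
  convert key using 2
  ring_nf

/-! ### Asymptotics of the increment covariance. -/

/-- The covariance of the increments of bifractional Brownian motion over `[i, i + 1]` and
`[j, j + 1]`. -/
noncomputable def bifractionalIncrementCov (H K : ℝ) (i j : ℕ) : ℝ :=
  bifractionalCov H K ((i : ℝ≥0) + 1) ((j : ℝ≥0) + 1) - bifractionalCov H K ((i : ℝ≥0) + 1) j -
    (bifractionalCov H K i ((j : ℝ≥0) + 1) - bifractionalCov H K i j)

lemma bifractionalCov_mul (H K : ℝ) (c x y : ℝ≥0) :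
    bifractionalCov H K (c * x) (c * y) = (c : ℝ) ^ (2 * H * K) * bifractionalCov H K x y := by
  have h1 : ((c * x : ℝ≥0) : ℝ) - ((c * y : ℝ≥0) : ℝ) = c * (x - y) := by push_cast; ring
  simp only [bifractionalCov]
  rw [h1, NNReal.coe_mul, NNReal.coe_mul, Real.mul_rpow c.coe_nonneg x.coe_nonneg,
    Real.mul_rpow c.coe_nonneg y.coe_nonneg, ← mul_add,
    Real.mul_rpow (by positivity) (by positivity), abs_mul, Real.mul_rpow (abs_nonneg _)
    (abs_nonneg _), ← Real.rpow_mul c.coe_nonneg, abs_of_nonneg c.coe_nonneg]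
  ring

/-- The distance of `q` to the axes and to the diagonal. -/
def gap (q : ℕ × ℕ) : ℕ := min (min q.1 q.2) (Nat.dist q.1 q.2)

lemma le_gap_iff {q : ℕ × ℕ} {m : ℕ} :
    m ≤ gap q ↔ m ≤ q.1 ∧ m ≤ q.2 ∧ (q.1 + m ≤ q.2 ∨ q.2 + m ≤ q.1) := by
  simp only [gap, Nat.dist]
  omega

lemma bifractionalIncrementCov_eq (H K : ℝ) (i j : ℕ) :
    bifractionalIncrementCov H K i j = (2 : ℝ) ^ (-K) *
      (((((i : ℝ) + 1) ^ (2 * H) + ((j : ℝ) + 1) ^ (2 * H)) ^ K -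
          (((i : ℝ) + 1) ^ (2 * H) + (j : ℝ) ^ (2 * H)) ^ K -
        (((i : ℝ) ^ (2 * H) + ((j : ℝ) + 1) ^ (2 * H)) ^ K -
          ((i : ℝ) ^ (2 * H) + (j : ℝ) ^ (2 * H)) ^ K)) +
        (|(i : ℝ) - j + 1| ^ (2 * H * K) + |(i : ℝ) - j - 1| ^ (2 * H * K) -
          2 * |(i : ℝ) - j| ^ (2 * H * K))) := by
  simp only [bifractionalIncrementCov, bifractionalCov]
  push_cast
  rw [show (i : ℝ) + 1 - (j + 1) = i - j by ring, show (i : ℝ) + 1 - j = i - j + 1 by ring,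
    show (i : ℝ) - (j + 1) = i - j - 1 by ring]
  ring

lemma two_rpow_neg_le_one {K : ℝ} (hK : 0 < K) : (2 : ℝ) ^ (-K) ≤ 1 :=
  Real.rpow_le_one_of_one_le_of_nonpos (by norm_num) (by linarith)

lemma tendsto_mixed_bound {H K : ℝ} (hH : H ∈ Set.Ioo (0 : ℝ) 1) (hK : K ∈ Set.Ioc (0 : ℝ) 1) :
    Tendsto (fun m : ℕ ↦ 4 * ((m : ℝ) * m) ^ (H * K - 1)) atTop (𝓝 0) := by
  have h : 0 < 1 - H * K := by nlinarith [hH.1, hH.2, hK.1, hK.2]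
  have h1 : Tendsto (fun m : ℕ ↦ (m : ℝ) * m) atTop atTop :=
    tendsto_natCast_atTop_atTop.atTop_mul_atTop₀ tendsto_natCast_atTop_atTop
  have := ((tendsto_rpow_neg_atTop h).comp h1).const_mul 4
  simpa [Function.comp_def] using this

/-- On the diagonal the second difference of `|x| ^ (2 H K)` is exactly 2; only the mixed difference
has to vanish. -/
lemma tendsto_bifractionalIncrementCov_self {H K : ℝ} (hH : H ∈ Set.Ioo (0 : ℝ) 1)
    (hK : K ∈ Set.Ioc (0 : ℝ) 1) :
    Tendsto (fun i : ℕ ↦ bifractionalIncrementCov H K i i) atTop (𝓝 ((2 : ℝ) ^ (1 - K))) := by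
  rw [tendsto_iff_norm_sub_tendsto_zero]
  refine squeeze_zero' (Eventually.of_forall fun _ ↦ norm_nonneg _) ?_ (tendsto_mixed_bound hH hK)
  filter_upwards [eventually_ge_atTop 1] with i hi
  have hi' : (1 : ℝ) ≤ i := by exact_mod_cast hi
  have h := abs_mixed_difference_le hH hK hi' le_rfl le_rfl
  have h0 : (2 * H * K) ≠ 0 := by have := hH.1; have := hK.1; positivity
  rw [bifractionalIncrementCov_eq, show (2 : ℝ) ^ (1 - K) = 2 ^ (-K) * 2 by
    rw [sub_eq_neg_add, Real.rpow_add_one (by norm_num)], ← mul_sub, Real.norm_eq_abs, abs_mul,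
    abs_of_pos (by positivity)]
  refine (mul_le_of_le_one_left (abs_nonneg _) (two_rpow_neg_le_one hK.1)).trans ?_
  refine le_trans (le_of_eq ?_) h
  congr 1
  simp [Real.zero_rpow h0]
  norm_num

lemma abs_second_difference_abs_rpow_le {β : ℝ} (h0 : 0 < β) (h2 : β < 2) {m x : ℝ} (hm : 0 < m)
    (hx : m + 1 ≤ |x|) :
    |(|x + 1| ^ β + |x - 1| ^ β - 2 * |x| ^ β)| ≤ 2 * m ^ (β - 2) := by
  rcases le_total 0 x with h | h
  · rw [abs_of_nonneg h] at hx
    rw [abs_of_nonneg (by linarith : 0 ≤ x + 1), abs_of_nonneg (by linarith : 0 ≤ x - 1),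
      abs_of_nonneg h]
    exact abs_second_difference_rpow_le h0 h2 hm (by linarith)
  · rw [abs_of_nonpos h] at hx
    rw [abs_of_nonpos (by linarith : x + 1 ≤ 0), abs_of_nonpos (by linarith : x - 1 ≤ 0),
      abs_of_nonpos h]
    have := abs_second_difference_rpow_le h0 h2 hm (x := -x) (by linarith)
    convert this using 2
    ring_nf

lemma tendsto_bifractionalIncrementCov {H K : ℝ} (hH : H ∈ Set.Ioo (0 : ℝ) 1)
    (hK : K ∈ Set.Ioc (0 : ℝ) 1) :
    Tendsto (fun q : ℕ × ℕ ↦ bifractionalIncrementCov H K q.1 q.2) (comap gap atTop) (𝓝 0) := by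
  have hHK0 : 0 < H * K := mul_pos hH.1 hK.1
  have hHK1 : H * K < 1 := by nlinarith [hH.1, hH.2, hK.1, hK.2]
  have hb : Tendsto (fun m : ℕ ↦ 4 * ((m : ℝ) * m) ^ (H * K - 1) +
      2 * ((m : ℝ) - 1) ^ (2 * H * K - 2)) atTop (𝓝 0) := by
    have h : 0 < 2 - 2 * H * K := by linarith
    have h1 : Tendsto (fun m : ℕ ↦ (m : ℝ) - 1) atTop atTop :=
      tendsto_atTop_add_const_right _ _ tendsto_natCast_atTop_atTop
    have := (tendsto_mixed_bound hH hK).add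
      (((tendsto_rpow_neg_atTop h).comp h1).const_mul 2)
    simpa [Function.comp_def] using this
  rw [tendsto_zero_iff_norm_tendsto_zero]
  refine squeeze_zero' (Eventually.of_forall fun _ ↦ norm_nonneg _) ?_ (hb.comp tendsto_comap)
  -- The second difference reaches one step closer to the diagonal, hence `gap q - 1` in the bound,
  -- which must be positive.
  filter_upwards [tendsto_comap.eventually (eventually_ge_atTop 2)] with q hq
  obtain ⟨h1, h2, h3⟩ := le_gap_iff.1 (le_refl (gap q))
  have hm : (2 : ℝ) ≤ gap q := by exact_mod_cast hq
  have h1' : (gap q : ℝ) ≤ q.1 := by exact_mod_cast h1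
  have h2' : (gap q : ℝ) ≤ q.2 := by exact_mod_cast h2
  have h3' : (gap q : ℝ) ≤ |(q.1 : ℝ) - q.2| := by
    rcases h3 with h3 | h3
    · have : (q.1 : ℝ) + gap q ≤ q.2 := by exact_mod_cast h3
      exact le_abs.2 (Or.inr (by linarith))
    · have : (q.2 : ℝ) + gap q ≤ q.1 := by exact_mod_cast h3
      exact le_abs.2 (Or.inl (by linarith))
  rw [bifractionalIncrementCov_eq, Real.norm_eq_abs, abs_mul, abs_of_pos (by positivity)]
  refine (mul_le_of_le_one_left (abs_nonneg _) (two_rpow_neg_le_one hK.1)).trans ?_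
  refine (abs_add_le _ _).trans (add_le_add (abs_mixed_difference_le hH hK (by linarith) h1' h2')
    (abs_second_difference_abs_rpow_le (by linarith) (by linarith) (by linarith) (by linarith)))

/-! ### From covariances to the variation. -/

/-- The normalized absolute powers of a triangular array of centered Gaussian variables, whose rows
share one asymptotically stationary and mixing covariance function `Γ`, obey the law of large
numbers. -/
lemma tendstoInMeasure_average_abs_rpow_gaussian {Ω : Type*} {mΩ : MeasurableSpace Ω}
    {P : Measure Ω} [IsProbabilityMeasure P] {Y : ℕ → ℕ → Ω → ℝ} {Γ : ℕ → ℕ → ℝ} {σ p : ℝ}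
    (hp : 0 < p) (hσ : 0 < σ)
    (hG : ∀ n i j, HasGaussianLaw (fun ω ↦ (Y n i ω, Y n j ω)) P)
    (h0 : ∀ n i, ∫ ω, Y n i ω ∂P = 0)
    (hcov : ∀ n ≠ 0, ∀ i j, ∫ ω, Y n i ω * Y n j ω ∂P = Γ i j)
    (hdiag : Tendsto (fun i ↦ Γ i i) atTop (𝓝 (σ ^ 2)))
    (hoff : Tendsto (fun q : ℕ × ℕ ↦ Γ q.1 q.2) (comap gap atTop) (𝓝 0)) :
    TendstoInMeasure P (fun (n : ℕ) ω ↦ (n : ℝ)⁻¹ * ∑ i ∈ Finset.range n,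
      (|Y n i ω| ^ p - σ ^ p * ∫ u, |u| ^ p ∂(gaussianReal 0 1))) atTop (fun _ ↦ (0 : ℝ)) := by
  set L := σ ^ p * ∫ u, |u| ^ p ∂(gaussianReal 0 1) with hL
  obtain ⟨A, hA⟩ := hdiag.bddAbove_range
  refine tendstoInMeasure_average_of_correlation_small
    (Y := fun n i ω ↦ |Y n i ω| ^ p - L)
    (fun n i ↦ (memLp_two_abs_rpow (hG n i i).fst hp).sub (memLp_const L))
    (fun n hn i ↦ integral_sq_abs_rpow_sub_le (hG n i i).fst (h0 n i) hp L
      ((hcov n hn i i).trans_le (hA ⟨i, rfl⟩))) ?_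
  have hl1 : Tendsto Prod.fst (comap gap atTop) atTop :=
    tendsto_atTop_mono (fun q ↦ (le_gap_iff.1 le_rfl).1) tendsto_comap
  have hl2 : Tendsto Prod.snd (comap gap atTop) atTop :=
    tendsto_atTop_mono (fun q ↦ (le_gap_iff.1 le_rfl).2.1) tendsto_comap
  -- The Gram–Schmidt coefficients `(a, b, c)` of the pair tend to `(σ, 0, σ)`, the independent
  -- case.
  have ha : Tendsto (fun q : ℕ × ℕ ↦ √(Γ q.1 q.1)) (comap gap atTop) (𝓝 σ) := by
    have := (hdiag.comp hl1).sqrt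
    rwa [Real.sqrt_sq hσ.le] at this
  have hb : Tendsto (fun q : ℕ × ℕ ↦ Γ q.1 q.2 / √(Γ q.1 q.1)) (comap gap atTop) (𝓝 0) := by
    have := hoff.div ha hσ.ne'
    rwa [zero_div] at this
  have hc : Tendsto (fun q : ℕ × ℕ ↦ √(Γ q.2 q.2 - (Γ q.1 q.2 / √(Γ q.1 q.1)) ^ 2))
      (comap gap atTop) (𝓝 σ) := by
    have := ((hdiag.comp hl2).sub (hb.pow 2)).sqrt
    rw [zero_pow two_ne_zero, sub_zero, Real.sqrt_sq hσ.le] at this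
    exact this
  have hlim := ((continuous_gaussianPowerCov hp L).tendsto (σ, 0, σ)).comp
    (ha.prodMk_nhds (hb.prodMk_nhds hc))
  rw [gaussianPowerCov_eq_zero hp hσ.le] at hlim
  intro ε hε
  -- Besides the small covariance, `M` secures `0 < √(Γ i i)`, needed to divide by `a`.
  obtain ⟨M, -, hM⟩ := (atTop_basis.comap gap).eventually_iff.1
    ((hlim.abs.eventually_le_const (by simpa using hε)).and (ha.eventually (eventually_gt_nhds hσ)))
  refine ⟨M, fun n hn i j hi hj hij ↦ ?_⟩
  obtain ⟨hle, hpos⟩ := hM (x := (i, j)) (le_gap_iff.2 ⟨hi, hj, hij⟩)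
  have hf : Continuous fun z : ℝ × ℝ ↦ (|z.1| ^ p - L) * (|z.2| ^ p - L) := by
    have := hp.le
    fun_prop (disch := assumption)
  have := integral_comp_hasGaussianLaw_prodMk (hG n i j) (h0 n i) (h0 n j) hpos
    (b := Γ i j / √(Γ i i)) (by rw [hcov n hn, Real.sq_sqrt (Real.sqrt_pos.1 hpos).le])
    (by rw [hcov n hn, mul_div_cancel₀ _ hpos.ne']) hf
  simp only at this
  rw [this, hcov n hn]
  exact hle

lemma hasGaussianLaw_increment_pair {Ω T : Type*} {mΩ : MeasurableSpace Ω} {P : Measure Ω}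
    {B : T → Ω → ℝ} (hB : IsGaussianProcess B P) (c : ℝ) (s t u v : T) :
    HasGaussianLaw (fun ω ↦ (c * (B t ω - B s ω), c * (B v ω - B u ω))) P := by
  classical
  let f : ({s, t, u, v} : Finset T) → ({s, t, u, v} : Finset T) →
      (({s, t, u, v} : Finset T) → ℝ) →L[ℝ] ℝ := fun x y ↦
    c • (ContinuousLinearMap.proj (R := ℝ) (φ := fun _ ↦ ℝ) y -
      ContinuousLinearMap.proj (R := ℝ) (φ := fun _ ↦ ℝ) x)
  exact (hB.hasGaussianLaw {s, t, u, v}).map_fun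
    ((f ⟨s, by simp⟩ ⟨t, by simp⟩).prod (f ⟨u, by simp⟩ ⟨v, by simp⟩))

lemma IsBifractionalBrownianMotion.integral_increment_mul_increment {Ω : Type*}
    {mΩ : MeasurableSpace Ω} {P : Measure Ω} {H K : ℝ} {B : ℝ≥0 → Ω → ℝ}
    (hB : IsBifractionalBrownianMotion H K B P) (s t u v : ℝ≥0) :
    ∫ ω, (B t ω - B s ω) * (B v ω - B u ω) ∂P =
      bifractionalCov H K t v - bifractionalCov H K t u -
        (bifractionalCov H K s v - bifractionalCov H K s u) := by
  have hi : ∀ x y, Integrable (fun ω ↦ B x ω * B y ω) P := fun x y ↦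
    (hB.isGaussianProcess.hasGaussianLaw_eval x).memLp_two.integrable_mul
      (hB.isGaussianProcess.hasGaussianLaw_eval y).memLp_two
  have : ∀ ω, (B t ω - B s ω) * (B v ω - B u ω) =
      (B t ω * B v ω - B t ω * B u ω) - (B s ω * B v ω - B s ω * B u ω) := fun ω ↦ by ring
  simp_rw [this]
  rw [integral_sub (by exact (hi _ _).sub (hi _ _)) (by exact (hi _ _).sub (hi _ _)),
    integral_sub (hi _ _) (hi _ _), integral_sub (hi _ _) (hi _ _)]
  simp only [hB.covariance_eq]

theorem mainTheorem5 {Ω : Type*} {mΩ : MeasurableSpace Ω} (P : Measure Ω) [IsProbabilityMeasure P]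
    {Ω' : Type*} {mΩ' : MeasurableSpace Ω'} (P' : Measure Ω') [IsProbabilityMeasure P']
    (H K : ℝ) (hH : H ∈ Set.Ioo (0 : ℝ) 1) (hK : K ∈ Set.Ioc (0 : ℝ) 1)
    (B : ℝ≥0 → Ω → ℝ) (hB : IsBifractionalBrownianMotion H K B P)
    (ξ : Ω' → ℝ) (hξ : HasLaw ξ (gaussianReal 0 1) P') :
    HasAlphaVariation B (1 / (H * K))
      (fun t _ => ((2 : ℝ) ^ ((1 - K) / 2)) ^ (1 / (H * K)) *
        (∫ ω', |ξ ω'| ^ (1 / (H * K)) ∂P') * (t : ℝ)) P := by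
  intro t
  have hHK : 0 < H * K := mul_pos hH.1 hK.1
  set p := 1 / (H * K) with hp_def
  have hp : 0 < p := by positivity
  have hξp : ∫ ω', |ξ ω'| ^ p ∂P' = ∫ u, |u| ^ p ∂(gaussianReal 0 1) := by
    have hm : Measurable fun u : ℝ ↦ |u| ^ p := by fun_prop
    exact hξ.integral_comp (f := fun u : ℝ ↦ |u| ^ p) hm.aestronglyMeasurable
  rw [hξp]
  set σ : ℝ := 2 ^ ((1 - K) / 2) with hσ_def
  have hσ : 0 < σ := by positivity
  set L := σ ^ p * ∫ u, |u| ^ p ∂(gaussianReal 0 1) with hL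
  -- At `t = 0` the mesh vanishes and cannot be rescaled, but every increment is zero.
  rcases eq_or_ne t 0 with rfl | ht
  · have h1 : variationSum B p 0 = fun _ _ ↦ 0 := by
      ext n ω
      simp [variationSum, Real.zero_rpow hp.ne']
    simp only [h1, NNReal.coe_zero, mul_zero]
    exact tendstoInMeasure_of_tendsto_ae (fun _ ↦ aestronglyMeasurable_const) (by simp)
  have htpos : (0 : ℝ) < t := by positivity
  let s : ℕ → ℝ := fun n ↦ ((t : ℝ) / n) ^ (-(H * K))
  let Y : ℕ → ℕ → Ω → ℝ := fun n i ω ↦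
    s n * (B (((i : ℝ≥0) + 1) * t / (n : ℝ≥0)) ω - B ((i : ℝ≥0) * t / (n : ℝ≥0)) ω)
  have hBint : ∀ x, Integrable (B x) P := fun x ↦
    (hB.isGaussianProcess.hasGaussianLaw_eval x).integrable
  have key := tendstoInMeasure_average_abs_rpow_gaussian (P := P) (Y := Y)
    (Γ := bifractionalIncrementCov H K) hp hσ
    (fun n i j ↦ hasGaussianLaw_increment_pair hB.isGaussianProcess _ _ _ _ _)
    (fun n i ↦ by
      simp only [Y]
      rw [integral_const_mul, integral_sub (hBint _) (hBint _), hB.centered, hB.centered]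
      simp)
    (fun n hn i j ↦ by
      have hc : (0 : ℝ) < (t : ℝ) / n := by positivity
      have hs : s n * s n * (((t / n : ℝ≥0) : ℝ) ^ (2 * H * K)) = 1 := by
        simp only [s, NNReal.coe_div, NNReal.coe_natCast]
        rw [← Real.rpow_add hc, ← Real.rpow_add hc]
        ring_nf
        simp
      have hdiv : ∀ x : ℝ≥0, x * t / n = t / n * x := fun x ↦ by ring
      have : ∀ ω, Y n i ω * Y n j ω = s n * s n *
          ((B (((i : ℝ≥0) + 1) * t / n) ω - B ((i : ℝ≥0) * t / n) ω) *
            (B (((j : ℝ≥0) + 1) * t / n) ω - B ((j : ℝ≥0) * t / n) ω)) := fun ω ↦ by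
        simp only [Y]; ring
      simp_rw [this]
      rw [integral_const_mul, hB.integral_increment_mul_increment]
      simp_rw [hdiv, bifractionalCov_mul]
      rw [← mul_sub, ← mul_sub, ← mul_sub, ← mul_assoc, hs, one_mul]
      rfl)
    (by
      have : σ ^ 2 = 2 ^ (1 - K) := by
        rw [hσ_def, ← Real.rpow_natCast, ← Real.rpow_mul (by norm_num)]
        norm_num
      rw [this]
      exact tendsto_bifractionalIncrementCov_self hH hK)
    (tendsto_bifractionalIncrementCov hH hK)
  -- Here `s n ^ p = (t / n)⁻¹`, because `p * (H * K) = 1`.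
  have hvar : ∀ n : ℕ, n ≠ 0 → ∀ ω, variationSum B p t n ω - L * t =
      t * ((n : ℝ)⁻¹ * ∑ i ∈ Finset.range n, (|Y n i ω| ^ p - L)) := by
    intro n hn ω
    have hc : (0 : ℝ) < (t : ℝ) / n := by positivity
    have hn' : (n : ℝ) ≠ 0 := by exact_mod_cast hn
    have hY : ∀ i, |Y n i ω| ^ p = ((t : ℝ) / n)⁻¹ *
        |B (((i : ℝ≥0) + 1) * t / n) ω - B ((i : ℝ≥0) * t / n) ω| ^ p := by
      intro i
      have hs : 0 < s n := Real.rpow_pos_of_pos hc _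
      simp only [Y]
      rw [abs_mul, Real.mul_rpow (abs_nonneg _) (abs_nonneg _), abs_of_pos hs]
      congr 1
      simp only [s]
      rw [← Real.rpow_mul hc.le, hp_def, neg_mul, mul_one_div_cancel hHK.ne', Real.rpow_neg_one]
    simp_rw [hY]
    rw [Finset.sum_sub_distrib, ← Finset.mul_sum, Finset.sum_const, Finset.card_range, nsmul_eq_mul,
      variationSum]
    set S := ∑ i ∈ Finset.range n,
      |B (((i : ℝ≥0) + 1) * t / n) ω - B ((i : ℝ≥0) * t / n) ω| ^ p
    field_simp
  rw [tendstoInMeasure_iff_norm] at key ⊢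
  intro ε hε
  refine (key (ε / t) (by positivity)).congr' ?_
  filter_upwards [eventually_ne_atTop 0] with n hn
  congr 1
  ext ω
  simp only [Set.mem_ofPred_eq]
  rw [hvar n hn ω, sub_zero, norm_mul (t : ℝ), Real.norm_of_nonneg htpos.le, div_le_iff₀' htpos]
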